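/- Let $\xi$ be a standard normal random variable on a probability space $(\Omega,\mathcal F,\mathbb P)$, and let $\{\xi_{n,k}\}_{1\le k\le n,\ n\ge 1}$ be a standard triangular array of random variables on the same space, that is, for each $n \geq 1$ the variables $\xi_{n,1},\dots,\xi_{n,n}$ are independent and square integrable, $\mathbb E[\xi_{n,k}]=0$ for all $n,k$, and $\sum_{k=1}^n\mathbb E[\xi_{n,k}^2]=1$ for all $n$. Suppose that Feller's condition $\lim_{n\to\infty}\max_{1\le k\le n}\mathbb E[\xi_{n,k}^2]=0$ holds. Then $$\limsup_{n\to\infty} W\Bigl(\xi,\sum_{k=1}^n\xi_{n,k}\Bigr)\le 8\,\sup_{\epsilon>0}\limsup_{n\to\infty}\sum_{k=1}^n\mathbb E\bigl[\xi_{n,k}^2\,;\,|\xi_{n,k}|>\epsilon\bigr].$$ Here the supremum on the right-hand side is the Lindeberg index $\mathrm{Lin}(\{\xi_{n,k}\})$, and $W(\eta,\eta')=\inf_\pi\int_{\mathbb R\times\mathbb R}|x-y|\,d\pi(x,y)$ is the Wasserstein distance, where the infimum is over all Borel probability measures $\pi$ on $\mathbb R\times\mathbb R$ whose first marginal is the law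 of $\eta$ and whose second marginal is the law of $\eta'$. -/

import Mathlib

open MeasureTheory ProbabilityTheory Filter Topology
open scoped ENNReal

/-- The Wasserstein distance of two Borel probability measures on `ℝ`: the infimum of
`∫ d(x, y) dπ(x, y)` over all Borel probability measures `π` on `ℝ × ℝ` with first marginal `P`
and second marginal `Q`. It takes values in `[0, ∞]`, and is finite when `P` and `Q` have finite
first absolute moments. -/
noncomputable def wassersteinDist (P Q : Measure ℝ) : ℝ≥0∞ :=
  ⨅ π ∈ {π : Measure (ℝ × ℝ) | IsProbabilityMeasure π ∧
      π.map Prod.fst = P ∧ π.map Prod.snd = Q},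
    ∫⁻ z, edist z.1 z.2 ∂π

/-- Standard triangular arrays: the entries `X n k` with `1 ≤ k ≤ n` are square integrable random
variables with mean zero, the entries of each row are independent, and the variances in each row
add up to one. The values of `X n k` for other indices are irrelevant. -/
structure IsSTA {Ω : Type*} [MeasurableSpace Ω] (μ : Measure Ω) (X : ℕ → ℕ → Ω → ℝ) : Prop where
  measurable : ∀ n, ∀ k ∈ Finset.Icc 1 n, Measurable (X n k)
  memLp : ∀ n, ∀ k ∈ Finset.Icc 1 n, MemLp (X n k) 2 μ
  indep : ∀ n, iIndepFun (fun k : Finset.Icc 1 n => X n k) μ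
  mean_zero : ∀ n, ∀ k ∈ Finset.Icc 1 n, ∫ ω, X n k ω ∂μ = 0
  sum_variance : ∀ n, 1 ≤ n → ∑ k ∈ Finset.Icc 1 n, ∫ ω, X n k ω ^ 2 ∂μ = 1

/-- Feller's condition: `max_{1 ≤ k ≤ n} E[X_{n,k}²] → 0` as `n → ∞`. -/
def FellerCondition {Ω : Type*} [MeasurableSpace Ω] (μ : Measure Ω) (X : ℕ → ℕ → Ω → ℝ) : Prop :=
  Tendsto
    (fun n : ℕ => (Finset.Icc 1 n).sup fun k => ∫⁻ ω, ENNReal.ofReal (X n k ω ^ 2) ∂μ)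
    atTop (𝓝 0)

/-- The Lindeberg index `sup_{ε > 0} limsup_n ∑_{k=1}^n E[X_{n,k}² ; |X_{n,k}| > ε]`. -/
noncomputable def lindebergIndex {Ω : Type*} [MeasurableSpace Ω] (μ : Measure Ω)
    (X : ℕ → ℕ → Ω → ℝ) : ℝ≥0∞ :=
  ⨆ (ε : ℝ) (_ : 0 < ε),
    limsup (fun n : ℕ => ∑ k ∈ Finset.Icc 1 n,
      ∫⁻ ω in {ω | ε < |X n k ω|}, ENNReal.ofReal (X n k ω ^ 2) ∂μ) atTop

/-! Stein's method. For a `C¹` function h with |h'| ≤ 1 and a standard normal Z, the equation f'(x)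
- x f(x) = h(x) - E h(Z) has a solution with |f| ≤ 2, |f'| ≤ 4 and f' Lipschitz with constant 6
(`exists_stein_solution`). Hence E h(S) - E h(Z) = E[f'(S) - S f(S)] for a row sum S.

Split this along the variances, which add up to one. If X is one summand and Y = S - X, independence
and E X = 0 turn E[X²] E f'(S) - E[X f(S)] into E[X²] E[f'(Y+X) - f'(Y)] minus E[X R], where R is
the first order Taylor remainder of f at Y. The Lipschitz bound on f' gives |R| ≤ 6X², used where
|X| ≤ ε; the bound on f' gives |R| ≤ 8|X|, used where |X| > ε. The latter is the source of the
constant 8; everything else is at most 12ε times the variance once all variances are at most ε²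
(`stein_summand_le`), which Feller's condition guarantees eventually. Then n → ∞ and ε → 0.

The passage from test functions to the Wasserstein distance uses one direction of duality on the
line: the quantile coupling bounds the distance by the `L¹` distance of the distribution functions
(`wassersteinDist_le_lintegral_cdf`), and continuous approximations of its sign, integrated, are
admissible test functions. -/

/-! ### Gaussian integrals and tail estimates -/

/-- The unnormalised standard Gaussian density. -/
noncomputable def gaussWeight (x : ℝ) : ℝ := Real.exp (-(1 / 2) * x ^ 2)

lemma gaussWeight_pos (x : ℝ) : 0 < gaussWeight x := Real.exp_pos _

lemma gaussWeight_neg (x : ℝ) : gaussWeight (-x) = gaussWeight x := by simp [gaussWeight]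

lemma continuous_gaussWeight : Continuous gaussWeight := by unfold gaussWeight; fun_prop

lemma hasDerivAt_gaussWeight (x : ℝ) : HasDerivAt gaussWeight (-(x * gaussWeight x)) x := by
  have h : HasDerivAt (fun x : ℝ => -(1 / 2) * x ^ 2) (-x) x := by
    have := (hasDerivAt_pow 2 x).const_mul (-(1 / 2) : ℝ)
    convert! this using 1
    simp
  have := h.exp
  convert! this using 1
  simp only [gaussWeight]; ring

lemma integrable_gaussWeight : Integrable gaussWeight :=
  integrable_exp_neg_mul_sq (b := 1 / 2) (by norm_num)

lemma integrable_mul_gaussWeight : Integrable fun x => x * gaussWeight x :=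
  integrable_mul_exp_neg_mul_sq (b := 1 / 2) (by norm_num)

lemma integrable_abs_mul_gaussWeight : Integrable fun x => |x| * gaussWeight x := by
  refine integrable_mul_gaussWeight.abs.congr (ae_of_all _ fun x => ?_)
  simp [abs_mul, abs_of_pos (gaussWeight_pos x)]

lemma tendsto_mul_gaussWeight_atTop : Tendsto (fun x => x * gaussWeight x) atTop (𝓝 0) := by
  have h := (rpow_mul_exp_neg_mul_sq_isLittleO_exp_neg (b := 1 / 2) (by norm_num) 1).trans_tendsto
    (Real.tendsto_exp_atBot.comp (tendsto_id.const_mul_atTop_of_neg (r := -(1 / 2))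
      (by norm_num)))
  simpa [gaussWeight] using h

lemma tendsto_gaussWeight_atTop : Tendsto gaussWeight atTop (𝓝 0) := by
  refine squeeze_zero' (Eventually.of_forall fun x => (gaussWeight_pos x).le) ?_
    tendsto_mul_gaussWeight_atTop
  filter_upwards [eventually_ge_atTop 1] with x hx
  nlinarith [gaussWeight_pos x]

lemma integral_Ioi_mul_gaussWeight (x : ℝ) :
    ∫ t in Set.Ioi x, t * gaussWeight t = gaussWeight x := by
  have h := integral_Ioi_of_hasDerivAt_of_tendsto' (a := x) (f := fun t => -gaussWeight t)
    (f' := fun t => t * gaussWeight t) (m := 0)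
    (fun t _ => by simpa using (hasDerivAt_gaussWeight t).fun_neg)
    integrable_mul_gaussWeight.integrableOn (by simpa using tendsto_gaussWeight_atTop.neg)
  simpa using h

lemma integral_gaussWeight : ∫ x, gaussWeight x = √(2 * Real.pi) := by
  have := integral_gaussian (1 / 2)
  simp only [gaussWeight]
  rw [this]; congr 1; ring

lemma integral_Ioi_zero_gaussWeight : ∫ x in Set.Ioi 0, gaussWeight x = √(2 * Real.pi) / 2 := by
  have := integral_gaussian_Ioi (1 / 2)
  simp only [gaussWeight]
  rw [this]; congr 2; ring

lemma integral_abs_mul_gaussWeight : ∫ x, |x| * gaussWeight x = 2 := by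
  have h := integral_comp_abs (f := fun x => x * gaussWeight x)
  have h2 : ∀ x, gaussWeight |x| = gaussWeight x := fun x => by simp [gaussWeight]
  simp only [h2] at h
  rw [h, integral_Ioi_mul_gaussWeight]
  simp [gaussWeight]

/-- After shifting the tail to start at 0, (t + x)² ≥ t² + x² for t, x ≥ 0 splits off the factor
`gaussWeight x`. -/
lemma integral_Ioi_gaussWeight_le {x : ℝ} (hx : 0 ≤ x) :
    ∫ t in Set.Ioi x, gaussWeight t ≤ √(2 * Real.pi) / 2 * gaussWeight x := by
  have h : ∫ t in Set.Ioi x, gaussWeight t = ∫ t in Set.Ioi 0, gaussWeight (t + x) := by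
    have := (measurePreserving_add_right volume x).setIntegral_preimage_emb
      (measurableEmbedding_addRight x) gaussWeight (Set.Ioi x)
    simpa using this.symm
  rw [h, ← integral_Ioi_zero_gaussWeight, ← integral_mul_const]
  refine setIntegral_mono_on (integrable_gaussWeight.comp_add_right x).integrableOn
    (integrable_gaussWeight.mul_const _).integrableOn measurableSet_Ioi fun t ht => ?_
  simp only [gaussWeight]
  rw [← Real.exp_add, Real.exp_le_exp]
  nlinarith [mul_nonneg hx (le_of_lt ht)]

lemma mul_integral_Ioi_gaussWeight_le (x : ℝ) :
    x * ∫ t in Set.Ioi x, gaussWeight t ≤ gaussWeight x := by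
  rw [← integral_Ioi_mul_gaussWeight x, ← integral_const_mul]
  refine setIntegral_mono_on (integrable_gaussWeight.const_mul _).integrableOn
    integrable_mul_gaussWeight.integrableOn measurableSet_Ioi fun t ht => ?_
  have : x < t := ht
  nlinarith [gaussWeight_pos t]

/-! ### Stein's equation and bounds on its solution -/

/-- The Gaussian weight is an integrating factor: (w · `gaussWeight`)' = r · `gaussWeight`, so the
decay at infinity represents w as a tail integral of r. -/
lemma abs_mul_gaussWeight_le_integral {w r : ℝ → ℝ} {c d x : ℝ} (hx : 0 ≤ x)
    (hw : ∀ x, HasDerivAt w (x * w x + r x) x) (hr : Continuous r)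
    (hrb : ∀ t, |r t| ≤ c + d * |t|)
    (hlim : Tendsto (fun x => w x * gaussWeight x) atTop (𝓝 0)) :
    |w x| * gaussWeight x ≤ c * (∫ t in Set.Ioi x, gaussWeight t) + d * gaussWeight x := by
  have hbi : Integrable fun t => c * gaussWeight t + d * (|t| * gaussWeight t) :=
    (integrable_gaussWeight.const_mul c).add (integrable_abs_mul_gaussWeight.const_mul d)
  have hb : ∀ t, ‖r t * gaussWeight t‖ ≤ c * gaussWeight t + d * (|t| * gaussWeight t) := by
    intro t
    rw [Real.norm_eq_abs, abs_mul, abs_of_pos (gaussWeight_pos t)]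
    nlinarith [hrb t, gaussWeight_pos t]
  have hi : Integrable fun t => r t * gaussWeight t :=
    hbi.mono' (hr.mul continuous_gaussWeight).aestronglyMeasurable (ae_of_all _ hb)
  have h := integral_Ioi_of_hasDerivAt_of_tendsto' (a := x) (f := fun t => w t * gaussWeight t)
    (f' := fun t => r t * gaussWeight t) (m := 0)
    (fun t _ => by
      convert! (hw t).mul (hasDerivAt_gaussWeight t) using 1
      ring) hi.integrableOn hlim
  have h2 : |w x| * gaussWeight x = ‖∫ t in Set.Ioi x, r t * gaussWeight t‖ := by
    rw [h]; simp [abs_of_pos (gaussWeight_pos x)]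
  rw [h2]
  refine (norm_integral_le_of_norm_le hbi.integrableOn (ae_of_all _ hb)).trans_eq ?_
  rw [integral_add (integrable_gaussWeight.const_mul c).integrableOn
    (integrable_abs_mul_gaussWeight.const_mul d).integrableOn, integral_const_mul,
    integral_const_mul, ← integral_Ioi_mul_gaussWeight x]
  congr 2
  refine setIntegral_congr_fun measurableSet_Ioi fun t ht => ?_
  rw [abs_of_nonneg (hx.trans (le_of_lt ht))]

lemma bound_of_hasDerivAt_of_nonneg {w r : ℝ → ℝ} {c d x : ℝ} (hc : 0 ≤ c) (hx : 0 ≤ x)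
    (hw : ∀ x, HasDerivAt w (x * w x + r x) x) (hr : Continuous r)
    (hrb : ∀ t, |r t| ≤ c + d * |t|)
    (hlim : Tendsto (fun x => w x * gaussWeight x) atTop (𝓝 0)) :
    |w x| ≤ c * (√(2 * Real.pi) / 2) + d ∧ |x * w x| ≤ c + d * |x| := by
  have h := abs_mul_gaussWeight_le_integral hx hw hr hrb hlim
  have hp := gaussWeight_pos x
  constructor
  · refine le_of_mul_le_mul_right ?_ hp
    nlinarith [mul_le_mul_of_nonneg_left (integral_Ioi_gaussWeight_le hx) hc]
  · refine le_of_mul_le_mul_right ?_ hp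
    rw [abs_mul, abs_of_nonneg hx]
    nlinarith [mul_le_mul_of_nonneg_left (mul_integral_Ioi_gaussWeight_le x) hc,
      mul_le_mul_of_nonneg_left h hx]

/-- Bounds on the solution of `w' = x w + r` which is negligible against `exp (x ^ 2 / 2)` at both
ends, for `r` of linear growth. -/
lemma bound_of_hasDerivAt {w r : ℝ → ℝ} {c d : ℝ} (hc : 0 ≤ c)
    (hw : ∀ x, HasDerivAt w (x * w x + r x) x) (hr : Continuous r)
    (hrb : ∀ t, |r t| ≤ c + d * |t|)
    (htop : Tendsto (fun x => w x * gaussWeight x) atTop (𝓝 0))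
    (hbot : Tendsto (fun x => w x * gaussWeight x) atBot (𝓝 0)) (x : ℝ) :
    |w x| ≤ c * (√(2 * Real.pi) / 2) + d ∧ |x * w x| ≤ c + d * |x| := by
  rcases le_total 0 x with hx | hx
  · exact bound_of_hasDerivAt_of_nonneg hc hx hw hr hrb htop
  -- The reflection x ↦ -w(-x) solves the same equation with r(-x) in place of r.
  · have h := bound_of_hasDerivAt_of_nonneg (w := fun x => -w (-x)) (r := fun x => r (-x))
      (c := c) (d := d) (x := -x) hc (by linarith)
      (fun y => by
        have := ((hw (-y)).scomp y (hasDerivAt_neg y)).neg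
        convert! this using 1
        simp)
      (hr.comp continuous_neg) (fun t => by simpa using hrb (-t))
      (by
        have := (hbot.comp tendsto_neg_atTop_atBot).neg
        simpa [Function.comp_def, gaussWeight_neg] using this)
    simpa using h

/-- The solution is the primitive of r · `gaussWeight` from -∞, divided by `gaussWeight`; centring
of r makes the primitive vanish at +∞ too. -/
lemma exists_hasDerivAt_eq_mul_add {r : ℝ → ℝ} (hr : Continuous r)
    (hi : Integrable fun t => r t * gaussWeight t) (h0 : ∫ t, r t * gaussWeight t = 0) :
    ∃ w : ℝ → ℝ, (∀ x, HasDerivAt w (x * w x + r x) x) ∧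
      Tendsto (fun x => w x * gaussWeight x) atTop (𝓝 0) ∧
      Tendsto (fun x => w x * gaussWeight x) atBot (𝓝 0) := by
  set G : ℝ → ℝ := fun x => ∫ t in Set.Iic x, r t * gaussWeight t with hG
  have hwG : ∀ x, G x / gaussWeight x * gaussWeight x = G x := fun x =>
    div_mul_cancel₀ _ (gaussWeight_pos x).ne'
  have hd : ∀ x, HasDerivAt G (r x * gaussWeight x) x := by
    intro x
    have h1 : ∀ y, G y = G 0 + ∫ t in (0 : ℝ)..y, r t * gaussWeight t := fun y => by
      rw [← intervalIntegral.integral_Iic_sub_Iic hi.integrableOn hi.integrableOn]; ring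
    have h2 := (intervalIntegral.integral_hasDerivAt_right (hi.intervalIntegrable (a := 0) (b := x))
      (hr.mul continuous_gaussWeight).aestronglyMeasurable.stronglyMeasurableAtFilter
      (hr.mul continuous_gaussWeight).continuousAt).const_add (G 0)
    exact h2.congr_of_eventuallyEq (Eventually.of_forall h1)
  refine ⟨fun x => G x / gaussWeight x, fun x => ?_, ?_, ?_⟩
  · have := (hd x).div (hasDerivAt_gaussWeight x) (gaussWeight_pos x).ne'
    convert! this using 1
    field_simp [(gaussWeight_pos x).ne']
    ring
  · simp only [hwG]
    rw [← h0]
    exact (aecover_Iic tendsto_id).integral_tendsto_of_countably_generated hi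
  · simp only [hwG]
    exact tendsto_integral_Iic_zero tendsto_id

lemma integral_gaussianReal_eq (h : ℝ → ℝ) :
    ∫ x, h x ∂(gaussianReal 0 1) = (√(2 * Real.pi))⁻¹ * ∫ x, h x * gaussWeight x := by
  rw [integral_gaussianReal_eq_integral_smul one_ne_zero, ← integral_const_mul]
  congr 1
  ext x
  have : -x ^ 2 / 2 = -(1 / 2) * x ^ 2 := by ring
  simp only [gaussianPDFReal, gaussWeight, smul_eq_mul, NNReal.coe_one, mul_one, sub_zero, this]
  ring

lemma abs_sub_le_of_hasDerivAt {f f' : ℝ → ℝ} {C : ℝ} (hf : ∀ x, HasDerivAt f (f' x) x)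
    (hb : ∀ x, |f' x| ≤ C) (x y : ℝ) : |f x - f y| ≤ C * |x - y| := by
  simpa using Convex.norm_image_sub_le_of_norm_hasDerivWithin_le (s := Set.univ) (f := f)
    (f' := f') (C := C) (fun x _ => (hf x).hasDerivWithinAt) (fun x _ => hb x) convex_univ
    (Set.mem_univ y) (Set.mem_univ x)

lemma tendsto_mul_gaussWeight_of_le {w : ℝ → ℝ} {a b : ℝ} (hw : ∀ x, |w x| ≤ a + b * |x|) :
    Tendsto (fun x => w x * gaussWeight x) atTop (𝓝 0) ∧
      Tendsto (fun x => w x * gaussWeight x) atBot (𝓝 0) := by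
  have h1 : ∀ v : ℝ → ℝ, (∀ x, |v x| ≤ a + b * |x|) →
      Tendsto (fun x => v x * gaussWeight x) atTop (𝓝 0) := by
    intro v hv
    have h2 : Tendsto (fun x => a * gaussWeight x + b * (x * gaussWeight x)) atTop (𝓝 0) := by
      simpa using (tendsto_gaussWeight_atTop.const_mul a).add
        (tendsto_mul_gaussWeight_atTop.const_mul b)
    refine squeeze_zero_norm' ?_ h2
    filter_upwards [eventually_ge_atTop 0] with x hx
    have h3 := hv x
    rw [abs_of_nonneg hx] at h3
    rw [Real.norm_eq_abs, abs_mul, abs_of_pos (gaussWeight_pos x)]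
    nlinarith [gaussWeight_pos x]
  refine ⟨h1 w hw, ?_⟩
  have h2 := (h1 (fun x => w (-x)) fun x => by simpa using hw (-x)).comp tendsto_neg_atBot_atTop
  simpa [Function.comp_def, gaussWeight_neg] using h2

/-- The solution of Stein's equation for a `C¹` function `h` with Lipschitz constant `1`. -/
theorem exists_stein_solution {h g : ℝ → ℝ} (hg : Continuous g) (hgb : ∀ x, |g x| ≤ 1)
    (hh : ∀ x, HasDerivAt h (g x) x) :
    ∃ f f' : ℝ → ℝ, (∀ x, HasDerivAt f (f' x) x) ∧ (∀ x, |f x| ≤ 2) ∧ (∀ x, |f' x| ≤ 4) ∧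
      (∀ x y, |f' x - f' y| ≤ 6 * |x - y|) ∧
      ∀ x, f' x - x * f x = h x - ∫ y, h y ∂(gaussianReal 0 1) := by
  have hlip := abs_sub_le_of_hasDerivAt hh hgb
  have hhc : Continuous h := continuous_iff_continuousAt.2 fun x => (hh x).continuousAt
  set s := √(2 * Real.pi) with hs
  have hspos : 0 < s := Real.sqrt_pos.2 (by positivity)
  have hint0 : Integrable fun x => (h x - h 0) * gaussWeight x := by
    refine integrable_abs_mul_gaussWeight.mono'
      ((hhc.sub continuous_const).mul continuous_gaussWeight).aestronglyMeasurable
      (ae_of_all _ fun x => ?_)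
    have := hlip x 0
    rw [sub_zero, one_mul] at this
    rw [Real.norm_eq_abs, abs_mul, abs_of_pos (gaussWeight_pos x)]
    exact mul_le_mul_of_nonneg_right this (gaussWeight_pos x).le
  have hint1 : Integrable fun x => h x * gaussWeight x := by
    refine (hint0.add (integrable_gaussWeight.const_mul (h 0))).congr (ae_of_all _ fun x => ?_)
    simp only [Pi.add_apply]; ring
  set N := ∫ y, h y ∂(gaussianReal 0 1) with hN
  have hNeq : s * N = ∫ x, h x * gaussWeight x := by
    rw [hN, integral_gaussianReal_eq, mul_inv_cancel_left₀ hspos.ne']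
  have hint2 : Integrable fun x => (h x - N) * gaussWeight x := by
    refine (hint1.sub (integrable_gaussWeight.const_mul N)).congr (ae_of_all _ fun x => ?_)
    simp only [Pi.sub_apply]; ring
  have hzero : ∫ x, (h x - N) * gaussWeight x = 0 := by
    have : ∀ x, (h x - N) * gaussWeight x = h x * gaussWeight x - N * gaussWeight x :=
      fun x => by ring
    simp_rw [this]
    rw [integral_sub hint1 (integrable_gaussWeight.const_mul N), integral_const_mul,
      integral_gaussWeight, ← hNeq]
    ring
  -- Here 2 / s is the first absolute moment of the standard normal law.
  have hN0 : |h 0 - N| ≤ 2 / s := by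
    have h1 : s * (N - h 0) = ∫ x, (h x - h 0) * gaussWeight x := by
      have : ∀ x, (h x - h 0) * gaussWeight x = h x * gaussWeight x - h 0 * gaussWeight x :=
        fun x => by ring
      simp_rw [this]
      rw [integral_sub hint1 (integrable_gaussWeight.const_mul _), integral_const_mul,
        integral_gaussWeight, ← hNeq]
      ring
    have h2 : |s * (N - h 0)| ≤ 2 := by
      rw [h1, ← integral_abs_mul_gaussWeight, ← Real.norm_eq_abs]
      refine norm_integral_le_of_norm_le integrable_abs_mul_gaussWeight (ae_of_all _ fun x => ?_)
      have := hlip x 0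
      rw [sub_zero, one_mul] at this
      rw [Real.norm_eq_abs, abs_mul, abs_of_pos (gaussWeight_pos x)]
      exact mul_le_mul_of_nonneg_right this (gaussWeight_pos x).le
    rw [abs_mul, abs_of_pos hspos] at h2
    rw [le_div_iff₀ hspos, abs_sub_comm]
    linarith
  have hrb : ∀ t, |h t - N| ≤ 2 / s + 1 * |t| := by
    intro t
    have h1 := hlip t 0
    rw [sub_zero] at h1
    have h2 := abs_add_le (h t - h 0) (h 0 - N)
    rw [sub_add_sub_cancel] at h2
    linarith
  have hrc : Continuous fun x => h x - N := hhc.sub continuous_const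
  obtain ⟨f, hf, htop, hbot⟩ := exists_hasDerivAt_eq_mul_add hrc hint2 hzero
  have hf2 : ∀ x, |f x| ≤ 2 := by
    intro x
    refine (bound_of_hasDerivAt (by positivity) hf hrc hrb htop hbot x).1.trans ?_
    rw [← hs]
    field_simp
    norm_num
  have hfc : Continuous f := continuous_iff_continuousAt.2 fun x => (hf x).continuousAt
  -- The derivative of f solves the same type of equation, with bounded forcing f + g, so the
  -- general bounds apply a second time and no second derivative of h is needed.
  have hf' : ∀ x, HasDerivAt (fun x => x * f x + (h x - N))
      (x * (x * f x + (h x - N)) + (f x + g x)) x := by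
    intro x
    convert! ((hasDerivAt_id x).mul (hf x)).add ((hh x).sub_const N) using 1
    simp only [id]
    ring
  have hgrow : ∀ x, |x * f x + (h x - N)| ≤ 2 / s + 3 * |x| := by
    intro x
    have h1 := abs_add_le (x * f x) (h x - N)
    rw [abs_mul] at h1
    nlinarith [hrb x, mul_le_mul_of_nonneg_left (hf2 x) (abs_nonneg x)]
  have hlim := tendsto_mul_gaussWeight_of_le hgrow
  have hr1 : ∀ t, |f t + g t| ≤ 3 + 0 * |t| := fun t => by
    linarith [abs_add_le (f t) (g t), hf2 t, hgb t]
  have hb := bound_of_hasDerivAt (by norm_num) hf' (hfc.add hg) hr1 hlim.1 hlim.2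
  -- With |f + g| ≤ 3 the bound on f' is 3 · s / 2, which this turns into 4. The Lipschitz constant
  -- 6 is 3 for x f' plus 3 for f + g.
  have hs83 : s ≤ 8 / 3 := by
    rw [hs]
    exact Real.sqrt_le_iff.2 ⟨by norm_num, by nlinarith [Real.pi_lt_d2]⟩
  refine ⟨f, fun x => x * f x + (h x - N), hf, hf2, fun x => ?_, ?_, fun x => by ring⟩
  · have := (hb x).1
    rw [← hs] at this
    linarith
  · refine abs_sub_le_of_hasDerivAt hf' fun x => ?_
    linarith [abs_add_le (x * (x * f x + (h x - N))) (f x + g x), (hb x).2, hr1 x]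

/-! ### Leave-one-out estimates for sums of independent variables -/

section SteinBound

variable {Ω : Type*} [MeasurableSpace Ω] {μ : Measure Ω} [IsProbabilityMeasure μ]

lemma stein_remainder_le {f f' : ℝ → ℝ} (hf : ∀ x, HasDerivAt f (f' x) x)
    (hf'b : ∀ x, |f' x| ≤ 4) (hf'l : ∀ x y, |f' x - f' y| ≤ 6 * |x - y|) (x y : ℝ) :
    |f (y + x) - f y - x * f' y| ≤ 6 * x ^ 2 ∧ |f (y + x) - f y - x * f' y| ≤ 8 * |x| := by
  constructor
  · have h := Convex.norm_image_sub_le_of_norm_hasDerivWithin_le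
      (s := Set.uIcc y (y + x)) (f := fun t => f t - t * f' y)
      (f' := fun t => f' t - 1 * f' y) (C := 6 * |x|) (x := y) (y := y + x)
      (fun t _ => ((hf t).sub ((hasDerivAt_id t).mul_const _)).hasDerivWithinAt)
      (fun t ht => by
        rw [one_mul, Real.norm_eq_abs]
        refine (hf'l t y).trans ?_
        have := Set.abs_sub_left_of_mem_uIcc ht
        rw [add_sub_cancel_left] at this
        linarith)
      (convex_uIcc _ _) Set.left_mem_uIcc Set.right_mem_uIcc
    have e : f (y + x) - (y + x) * f' y - (f y - y * f' y) = f (y + x) - f y - x * f' y := by ring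
    rw [e, Real.norm_eq_abs, Real.norm_eq_abs, add_sub_cancel_left, mul_assoc, abs_mul_abs_self]
      at h
    linarith [sq x]
  · have h1 := abs_sub_le_of_hasDerivAt hf hf'b (y + x) y
    rw [add_sub_cancel_left] at h1
    have h2 := abs_sub (f (y + x) - f y) (x * f' y)
    rw [abs_mul] at h2
    nlinarith [mul_le_mul_of_nonneg_left (hf'b y) (abs_nonneg x)]

lemma stein_summand_le {f f' : ℝ → ℝ} (hf : ∀ x, HasDerivAt f (f' x) x)
    (hfb : ∀ x, |f x| ≤ 2) (hf'b : ∀ x, |f' x| ≤ 4)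
    (hf'l : ∀ x y, |f' x - f' y| ≤ 6 * |x - y|)
    {X Y : Ω → ℝ} (hX : Measurable X) (hY : Measurable Y) (hX2 : MemLp X 2 μ)
    (hXY : IndepFun Y X μ) (h0 : ∫ ω, X ω ∂μ = 0) {ε : ℝ} (hε : 0 < ε)
    (hσ : ∫ ω, X ω ^ 2 ∂μ ≤ ε ^ 2) :
    |(∫ ω, X ω ^ 2 ∂μ) * ∫ ω, f' (Y ω + X ω) ∂μ - ∫ ω, X ω * f (Y ω + X ω) ∂μ| ≤
      8 * (∫ ω in {ω | ε < |X ω|}, X ω ^ 2 ∂μ) + 12 * ε * ∫ ω, X ω ^ 2 ∂μ := by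
  have hfm : Measurable f :=
    (continuous_iff_continuousAt.2 fun x => (hf x).continuousAt).measurable
  have hf'm : Measurable f' := by
    have : deriv f = f' := funext fun x => (hf x).deriv
    rw [← this]; exact measurable_deriv f
  have hXi : Integrable X μ := hX2.integrable (by norm_num)
  have hXsq : Integrable (fun ω => X ω ^ 2) μ := hX2.integrable_sq
  have hbdd : ∀ {u : ℝ → ℝ} {Z : Ω → ℝ} {C : ℝ}, Measurable u → (∀ x, |u x| ≤ C) →
      Measurable Z → Integrable (fun ω => u (Z ω)) μ := fun hu hC hZ =>
    Integrable.of_bound (hu.comp hZ).aestronglyMeasurable _ (ae_of_all _ fun ω => hC _)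
  have hmul : ∀ {u : ℝ → ℝ} {V Z : Ω → ℝ} {C : ℝ}, Integrable V μ → Measurable u →
      (∀ x, |u x| ≤ C) → Measurable Z → Integrable (fun ω => V ω * u (Z ω)) μ :=
    fun hV hu hC hZ => hV.mul_bdd (hu.comp hZ).aestronglyMeasurable (ae_of_all _ fun ω => hC _)
  have hA : Integrable (fun ω => X ω * f (Y ω)) μ := hmul hXi hfm hfb hY
  have hB : Integrable (fun ω => X ω ^ 2 * f' (Y ω)) μ := hmul hXsq hf'm hf'b hY
  have hC : Integrable (fun ω => X ω * f (Y ω + X ω)) μ := hmul hXi hfm hfb (hY.add hX)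
  have hD : Integrable (fun ω => f' (Y ω + X ω)) μ := hbdd hf'm hf'b (hY.add hX)
  have hE : Integrable (fun ω => f' (Y ω)) μ := hbdd hf'm hf'b hY
  set v := ∫ ω, X ω ^ 2 ∂μ with hv
  have hv0 : 0 ≤ v := integral_nonneg fun ω => sq_nonneg _
  have e1 : ∫ ω, X ω * f (Y ω) ∂μ = 0 := by
    have := (hXY.comp hfm measurable_id).integral_mul_eq_mul_integral
      (hfm.comp hY).aestronglyMeasurable hX.aestronglyMeasurable
    simp only [Function.comp_def, id, Pi.mul_apply, h0, mul_zero] at this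
    simpa only [mul_comm] using this
  have e2 : ∫ ω, X ω ^ 2 * f' (Y ω) ∂μ = v * ∫ ω, f' (Y ω) ∂μ := by
    have := (hXY.comp hf'm (measurable_id.pow_const 2)).integral_mul_eq_mul_integral
      (hf'm.comp hY).aestronglyMeasurable (hX.pow_const 2).aestronglyMeasurable
    simp only [Function.comp_def, id, Pi.mul_def] at this
    simp only [mul_comm _ (f' _), this]
    exact mul_comm _ _
  have e3 : v * ∫ ω, f' (Y ω + X ω) ∂μ - ∫ ω, X ω * f (Y ω + X ω) ∂μ =
      ∫ ω, (v * f' (Y ω + X ω) - v * f' (Y ω)) -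
        (X ω * f (Y ω + X ω) - X ω * f (Y ω) - X ω ^ 2 * f' (Y ω)) ∂μ := by
    rw [integral_sub ((hD.const_mul v).sub' (hE.const_mul v)) ((hC.sub' hA).sub' hB),
      integral_sub (hD.const_mul v) (hE.const_mul v), integral_sub (hC.sub' hA) hB,
      integral_sub hC hA, integral_const_mul, integral_const_mul, e1, e2]
    ring
  have hms : MeasurableSet {ω | ε < |X ω|} := measurableSet_lt measurable_const hX.abs
  have hI : Integrable (fun ω => Set.indicator {ω | ε < |X ω|} (fun ω => X ω ^ 2) ω) μ :=
    hXsq.indicator hms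
  have hF : Integrable (fun ω => 6 * v * (ε + X ω ^ 2 / ε) / 2 + 6 * ε * X ω ^ 2) μ :=
    (((integrable_const ε).fun_add (hXsq.div_const ε)).const_mul (6 * v)).div_const 2 |>.add
      (hXsq.const_mul (6 * ε))
  rw [e3, ← Real.norm_eq_abs]
  refine (norm_integral_le_of_norm_le (hF.add (hI.const_mul 8)) (ae_of_all _ fun ω => ?_)).trans ?_
  · obtain ⟨r1, r2⟩ := stein_remainder_le hf hf'b hf'l (X ω) (Y ω)
    have a1 : |v * f' (Y ω + X ω) - v * f' (Y ω)| ≤ 6 * v * (ε + X ω ^ 2 / ε) / 2 := by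
      rw [← mul_sub, abs_mul, abs_of_nonneg hv0]
      have h1 := hf'l (Y ω + X ω) (Y ω)
      rw [add_sub_cancel_left] at h1
      -- This form of the arithmetic-geometric mean inequality replaces Cauchy-Schwarz: its
      -- expectation is at most ε because v ≤ ε².
      have h2 : |X ω| ≤ (ε + X ω ^ 2 / ε) / 2 := by
        rw [← sq_abs (X ω)]
        have : (ε + |X ω| ^ 2 / ε) / 2 - |X ω| = (ε - |X ω|) ^ 2 / (2 * ε) := by
          field_simp; ring
        have h3 : 0 ≤ (ε - |X ω|) ^ 2 / (2 * ε) := by positivity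
        linarith
      nlinarith
    have a2 : |X ω * f (Y ω + X ω) - X ω * f (Y ω) - X ω ^ 2 * f' (Y ω)| ≤
        6 * ε * X ω ^ 2 + 8 * Set.indicator {ω | ε < |X ω|} (fun ω => X ω ^ 2) ω := by
      have e : X ω * f (Y ω + X ω) - X ω * f (Y ω) - X ω ^ 2 * f' (Y ω) =
        X ω * (f (Y ω + X ω) - f (Y ω) - X ω * f' (Y ω)) := by ring
      rw [e, abs_mul]
      by_cases hm : ε < |X ω|
      · rw [Set.indicator_of_mem (show ω ∈ {ω | ε < |X ω|} from hm)]
        have := mul_le_mul_of_nonneg_left r2 (abs_nonneg (X ω))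
        have h4 : 0 ≤ 6 * ε * X ω ^ 2 := by positivity
        nlinarith [sq_abs (X ω)]
      · rw [Set.indicator_of_notMem (show ω ∉ {ω | ε < |X ω|} from hm)]
        have := mul_le_mul (not_lt.1 hm) r1 (abs_nonneg _) hε.le
        linarith
    have a3 := abs_sub (v * f' (Y ω + X ω) - v * f' (Y ω))
      (X ω * f (Y ω + X ω) - X ω * f (Y ω) - X ω ^ 2 * f' (Y ω))
    rw [Real.norm_eq_abs]
    simp only [Pi.add_apply]
    linarith
  · simp only [Pi.add_apply]
    rw [integral_add hF (hI.const_mul 8), integral_const_mul, integral_indicator hms,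
      integral_add ((((integrable_const ε).fun_add (hXsq.div_const ε)).const_mul (6 * v)).div_const 2)
        (hXsq.const_mul (6 * ε)), integral_div, integral_const_mul,
      integral_add (integrable_const ε) (hXsq.div_const ε), integral_div, integral_const_mul,
      integral_const, ← hv]
    simp only [probReal_univ, smul_eq_mul, one_mul]
    have h5 : v / ε ≤ ε := by rw [div_le_iff₀ hε]; nlinarith
    nlinarith

lemma abs_integral_stein_le {ι : Type*} [Fintype ι] {f f' : ℝ → ℝ}
    (hf : ∀ x, HasDerivAt f (f' x) x)
    (hfb : ∀ x, |f x| ≤ 2) (hf'b : ∀ x, |f' x| ≤ 4)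
    (hf'l : ∀ x y, |f' x - f' y| ≤ 6 * |x - y|)
    {X : ι → Ω → ℝ} (hX : ∀ k, Measurable (X k)) (hX2 : ∀ k, MemLp (X k) 2 μ)
    (hind : iIndepFun X μ) (h0 : ∀ k, ∫ ω, X k ω ∂μ = 0) (hsum : ∑ k, ∫ ω, X k ω ^ 2 ∂μ = 1)
    {ε : ℝ} (hε : 0 < ε) (hσ : ∀ k, ∫ ω, X k ω ^ 2 ∂μ ≤ ε ^ 2) :
    |∫ ω, (f' (∑ k, X k ω) - (∑ k, X k ω) * f (∑ k, X k ω)) ∂μ| ≤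
      8 * ∑ k, (∫ ω in {ω | ε < |X k ω|}, X k ω ^ 2 ∂μ) + 12 * ε := by
  classical
  have hSm : Measurable fun ω => ∑ k, X k ω := Finset.measurable_fun_sum _ fun k _ => hX k
  have hfm : Measurable f :=
    (continuous_iff_continuousAt.2 fun x => (hf x).continuousAt).measurable
  have hf'm : Measurable f' := by
    have : deriv f = f' := funext fun x => (hf x).deriv
    rw [← this]; exact measurable_deriv f
  have hA : Integrable (fun ω => f' (∑ k, X k ω)) μ :=
    Integrable.of_bound (hf'm.comp hSm).aestronglyMeasurable _ (ae_of_all _ fun ω => hf'b _)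
  have hB : ∀ j, Integrable (fun ω => X j ω * f (∑ k, X k ω)) μ := fun j =>
    ((hX2 j).integrable (by norm_num)).mul_bdd (hfm.comp hSm).aestronglyMeasurable
      (ae_of_all _ fun ω => hfb _)
  have e : ∫ ω, (f' (∑ k, X k ω) - (∑ k, X k ω) * f (∑ k, X k ω)) ∂μ =
      ∑ j, ((∫ ω, X j ω ^ 2 ∂μ) * ∫ ω, f' (∑ k, X k ω) ∂μ -
        ∫ ω, X j ω * f (∑ k, X k ω) ∂μ) := by
    rw [Finset.sum_sub_distrib, ← Finset.sum_mul, hsum, one_mul,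
      ← integral_finsetSum _ fun j _ => hB j,
      ← integral_sub hA (integrable_finsetSum _ fun j _ => hB j)]
    simp only [Finset.sum_mul]
  rw [e]
  refine (Finset.abs_sum_le_sum_abs _ _).trans ?_
  have : 8 * ∑ k, (∫ ω in {ω | ε < |X k ω|}, X k ω ^ 2 ∂μ) + 12 * ε =
      ∑ k, (8 * (∫ ω in {ω | ε < |X k ω|}, X k ω ^ 2 ∂μ) + 12 * ε * ∫ ω, X k ω ^ 2 ∂μ) := by
    rw [Finset.sum_add_distrib, ← Finset.mul_sum, ← Finset.mul_sum, hsum, mul_one]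
  rw [this]
  refine Finset.sum_le_sum fun j _ => ?_
  have hi := hind.indepFun_finsetSum_of_notMem hX (Finset.notMem_erase j Finset.univ)
  have hY : Measurable (∑ k ∈ Finset.univ.erase j, X k) := by
    convert! Finset.measurable_fun_sum (Finset.univ.erase j) fun k _ => hX k using 1
    ext ω; simp
  have hs : ∀ ω, ∑ k, X k ω = (∑ k ∈ Finset.univ.erase j, X k) ω + X j ω := fun ω => by
    rw [Finset.sum_apply, Finset.sum_erase_add _ _ (Finset.mem_univ j)]
  simp only [hs]
  exact stein_summand_le hf hfb hf'b hf'l (hX j) hY (hX2 j) hi (h0 j) hε (hσ j)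

end SteinBound

/-! ### The quantile coupling -/

/-- The quantile function of a measure on `ℝ`, extended by zero outside of `(0, 1)`. -/
noncomputable def quantile (P : Measure ℝ) (u : ℝ) : ℝ :=
  open Classical in if u ∈ Set.Ioo (0 : ℝ) 1 then sInf {x | u ≤ cdf P x} else 0

lemma quantile_le_iff (P : Measure ℝ) {u : ℝ} (hu : u ∈ Set.Ioo (0 : ℝ) 1) (x : ℝ) :
    quantile P u ≤ x ↔ u ≤ cdf P x := by
  rw [quantile, if_pos hu]
  set S := {x | u ≤ cdf P x} with hS
  have hne : S.Nonempty := by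
    obtain ⟨y, hy⟩ := ((tendsto_cdf_atTop P).eventually_const_lt hu.2).exists
    exact ⟨y, hy.le⟩
  have hbdd : BddBelow S := by
    obtain ⟨y, hy⟩ := ((tendsto_cdf_atBot P).eventually_lt_const hu.1).exists
    refine ⟨y, fun z hz => ?_⟩
    by_contra! hlt
    exact absurd (hz.trans (monotone_cdf P hlt.le)) (not_le.2 hy)
  -- Right continuity of the distribution function shows that the infimum is attained.
  have hmem : u ≤ cdf P (sInf S) := by
    have hc := ((cdf P).right_continuous (sInf S)).mono_left
      (nhdsWithin_mono _ Set.Ioi_subset_Ici_self)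
    refine ge_of_tendsto hc ?_
    filter_upwards [self_mem_nhdsWithin] with y hy
    obtain ⟨z, hz, hzy⟩ := (csInf_lt_iff hbdd hne).1 hy
    exact hz.trans (monotone_cdf P hzy.le)
  exact ⟨fun h => hmem.trans (monotone_cdf P h), fun h => csInf_le hbdd h⟩

lemma measurable_quantile (P : Measure ℝ) : Measurable (quantile P) := by
  refine measurable_of_Iic fun x => ?_
  have : quantile P ⁻¹' Set.Iic x = (Set.Ioo 0 1 ∩ Set.Iic (cdf P x)) ∪
      ((Set.Ioo (0 : ℝ) 1)ᶜ ∩ {_u | (0 : ℝ) ≤ x}) := by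
    ext u
    by_cases hu : u ∈ Set.Ioo (0 : ℝ) 1
    · simp only [Set.mem_preimage, Set.mem_Iic, quantile_le_iff P hu, Set.mem_union,
        Set.mem_inter_iff, hu, Set.mem_compl_iff, true_and, not_true, false_and, or_false]
    · have h0 : quantile P u = 0 := if_neg hu
      simp only [Set.mem_preimage, Set.mem_Iic, Set.mem_union, h0, Set.mem_inter_iff, hu,
        Set.mem_compl_iff, true_and, not_false_eq_true, false_and, false_or, Set.mem_ofPred_eq]
  rw [this]
  exact (measurableSet_Ioo.inter measurableSet_Iic).union
    (measurableSet_Ioo.compl.inter (MeasurableSet.const _))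

lemma isProbabilityMeasure_restrict_Ioo :
    IsProbabilityMeasure (volume.restrict (Set.Ioo (0 : ℝ) 1)) := ⟨by simp⟩

lemma map_quantile (P : Measure ℝ) [IsProbabilityMeasure P] :
    (volume.restrict (Set.Ioo (0 : ℝ) 1)).map (quantile P) = P := by
  have := isProbabilityMeasure_restrict_Ioo
  have := Measure.isProbabilityMeasure_map (μ := volume.restrict (Set.Ioo (0 : ℝ) 1))
    (measurable_quantile P).aemeasurable
  refine Measure.ext_of_Iic _ _ fun x => ?_
  rw [Measure.map_apply (measurable_quantile P) measurableSet_Iic,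
    Measure.restrict_apply (measurable_quantile P measurableSet_Iic), ← ofReal_cdf P x]
  have h1 : quantile P ⁻¹' Set.Iic x ∩ Set.Ioo 0 1 = Set.Ioo 0 1 ∩ Set.Iic (cdf P x) := by
    ext u
    by_cases hu : u ∈ Set.Ioo (0 : ℝ) 1
    · simp only [Set.mem_inter_iff, Set.mem_preimage, Set.mem_Iic, quantile_le_iff P hu, hu,
        and_true, true_and]
    · simp only [Set.mem_inter_iff, hu, and_false, false_and]
  rw [h1]
  refine le_antisymm ?_ ?_
  · refine (measure_mono (t := Set.Ioc 0 (cdf P x)) fun u hu => ⟨hu.1.1, hu.2⟩).trans ?_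
    simp
  · refine le_trans ?_ (measure_mono (s := Set.Ioo 0 (cdf P x))
      fun u hu => ⟨⟨hu.1, hu.2.trans_le (cdf_le_one P x)⟩, hu.2.le⟩)
    simp

/-- Both quantile functions are evaluated at the same uniform variable. The transport cost is then
the area between their graphs, and slicing that region horizontally instead of vertically gives the
area between the distribution functions. -/
lemma wassersteinDist_le_lintegral_cdf (P Q : Measure ℝ) [IsProbabilityMeasure P]
    [IsProbabilityMeasure Q] :
    wassersteinDist P Q ≤ ∫⁻ t, ENNReal.ofReal |cdf P t - cdf Q t| := by
  have := isProbabilityMeasure_restrict_Ioo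
  set ν := volume.restrict (Set.Ioo (0 : ℝ) 1) with hν
  have hm := (measurable_quantile P).prodMk (measurable_quantile Q)
  have hle : wassersteinDist P Q ≤ ∫⁻ u, edist (quantile P u) (quantile Q u) ∂ν := by
    have hπ : ν.map (fun u => (quantile P u, quantile Q u)) ∈ {π : Measure (ℝ × ℝ) |
        IsProbabilityMeasure π ∧ π.map Prod.fst = P ∧ π.map Prod.snd = Q} := by
      refine ⟨?_, ?_, ?_⟩
      · exact Measure.isProbabilityMeasure_map hm.aemeasurable
      · rw [Measure.map_map measurable_fst hm]; exact map_quantile P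
      · rw [Measure.map_map measurable_snd hm]; exact map_quantile Q
    refine (iInf₂_le _ hπ).trans_eq ?_
    rw [lintegral_map measurable_edist hm]
  refine hle.trans ?_
  set A : Set (ℝ × ℝ) := {p | (quantile P p.1 ≤ p.2 ∧ p.2 < quantile Q p.1) ∨
    (quantile Q p.1 ≤ p.2 ∧ p.2 < quantile P p.1)} with hA
  have hAm : MeasurableSet A := by
    have h1 : Measurable fun p : ℝ × ℝ => quantile P p.1 :=
      (measurable_quantile P).comp measurable_fst
    have h2 : Measurable fun p : ℝ × ℝ => quantile Q p.1 :=
      (measurable_quantile Q).comp measurable_fst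
    exact ((measurableSet_le h1 measurable_snd).inter (measurableSet_lt measurable_snd h2)).union
      ((measurableSet_le h2 measurable_snd).inter (measurableSet_lt measurable_snd h1))
  have h1 : ∀ u, edist (quantile P u) (quantile Q u) ≤ volume (Prod.mk u ⁻¹' A) := by
    intro u
    rw [edist_dist, Real.dist_eq]
    rcases le_total (quantile P u) (quantile Q u) with h | h
    · rw [abs_sub_comm, abs_of_nonneg (sub_nonneg.2 h), ← Real.volume_Ico]
      exact measure_mono fun t ht => Or.inl ht
    · rw [abs_of_nonneg (sub_nonneg.2 h), ← Real.volume_Ico]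
      exact measure_mono fun t ht => Or.inr ht
  refine (lintegral_mono h1).trans ?_
  rw [← Measure.prod_apply hAm, Measure.prod_apply_symm hAm]
  refine lintegral_mono fun t => ?_
  rw [hν, Measure.restrict_apply (measurable_prodMk_right hAm), ← Real.volume_uIoc]
  refine measure_mono ?_
  rintro u ⟨hu, hu1⟩
  simp only [hA, Set.mem_preimage, Set.mem_ofPred_eq, quantile_le_iff _ hu1, ← not_le] at hu
  rw [Set.mem_uIoc]
  rcases hu with h | h
  · exact Or.inl ⟨not_le.1 h.2, h.1⟩
  · exact Or.inr ⟨not_le.1 h.2, h.1⟩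

/-! ### Duality with smooth test functions -/

lemma ite_sub_ite_eq_indicator {a b : ℝ} (hab : b ≤ a) :
    (fun t : ℝ => ((if b ≤ t then 1 else 0) - (if a ≤ t then 1 else 0) : ℝ)) =
      (Set.Ico b a).indicator 1 := by
  ext t
  by_cases h1 : b ≤ t <;> by_cases h2 : a ≤ t <;> simp [h1, h2, Set.indicator]
  linarith

lemma integrable_ite_sub_ite (a b : ℝ) :
    Integrable (fun t : ℝ => ((if b ≤ t then 1 else 0) - (if a ≤ t then 1 else 0) : ℝ)) ∧
      ∫ t, ‖((if b ≤ t then 1 else 0) - (if a ≤ t then 1 else 0) : ℝ)‖ = |a - b| := by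
  have key : ∀ {a b : ℝ}, b ≤ a →
      Integrable (fun t : ℝ => ((if b ≤ t then 1 else 0) - (if a ≤ t then 1 else 0) : ℝ)) ∧
      ∫ t, ‖((if b ≤ t then 1 else 0) - (if a ≤ t then 1 else 0) : ℝ)‖ = |a - b| := by
    intro a b hab
    constructor
    · rw [ite_sub_ite_eq_indicator hab]
      exact (integrable_indicator_iff measurableSet_Ico).2 (integrableOn_const (by simp))
    · have h : ∀ t : ℝ, ‖((if b ≤ t then 1 else 0) - (if a ≤ t then 1 else 0) : ℝ)‖ =
          (Set.Ico b a).indicator 1 t := by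
        intro t
        rw [← ite_sub_ite_eq_indicator hab]
        refine Real.norm_of_nonneg ?_
        have := congrFun (ite_sub_ite_eq_indicator hab) t
        rw [this]
        exact Set.indicator_nonneg (fun _ _ => zero_le_one) t
      simp_rw [h]
      rw [integral_indicator_one measurableSet_Ico, Real.volume_real_Ico_of_le hab,
        abs_of_nonneg (sub_nonneg.2 hab)]
  rcases le_total b a with hab | hab
  · exact key hab
  · obtain ⟨h1, h2⟩ := key hab
    refine ⟨h1.neg.congr (ae_of_all _ fun t => neg_sub _ _), ?_⟩
    rw [abs_sub_comm, ← h2]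
    simp_rw [norm_sub_rev]

lemma integral_mul_ite_sub_ite {h g : ℝ → ℝ} (hg : Continuous g)
    (hh : ∀ x, HasDerivAt h (g x) x) (a b : ℝ) :
    ∫ t, g t * ((if b ≤ t then 1 else 0) - (if a ≤ t then 1 else 0)) = h a - h b := by
  have key : ∀ {a b : ℝ}, b ≤ a →
      ∫ t, g t * ((if b ≤ t then 1 else 0) - (if a ≤ t then 1 else 0)) = h a - h b := by
    intro a b hab
    have h1 : ∀ t : ℝ, g t * ((if b ≤ t then 1 else 0) - (if a ≤ t then 1 else 0)) =
        (Set.Ico b a).indicator g t := by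
      intro t
      have := congrFun (ite_sub_ite_eq_indicator hab) t
      rw [this]
      by_cases ht : t ∈ Set.Ico b a <;> simp [ht]
    simp_rw [h1]
    rw [integral_indicator measurableSet_Ico, integral_Ico_eq_integral_Ioc,
      ← intervalIntegral.integral_of_le hab]
    exact intervalIntegral.integral_eq_sub_of_hasDerivAt (fun x _ => hh x)
      (hg.intervalIntegrable _ _)
  rcases le_total b a with hab | hab
  · exact key hab
  · have := key hab
    rw [← neg_sub (h b), ← this, ← integral_neg]
    congr 1; ext t; ring

/-- For the test function `h` with derivative `g`, the difference of the expectations is the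
integral of `g` against the difference of the distribution functions. -/
lemma integral_cdf_sub_cdf {P Q : Measure ℝ} [IsProbabilityMeasure P] [IsProbabilityMeasure Q]
    (hP : Integrable id P) (hQ : Integrable id Q) :
    Integrable (fun t => cdf Q t - cdf P t) ∧
    ∀ h g : ℝ → ℝ, Continuous g → (∀ x, |g x| ≤ 1) → (∀ x, HasDerivAt h (g x) x) →
      ∫ x, h x ∂P - ∫ x, h x ∂Q = ∫ t, g t * (cdf Q t - cdf P t) := by
  -- For fixed (a, b), K is the signed indicator of the interval between b and a, so h a - h b = ∫ g
  -- K. Fubini under the independent coupling applies because ∫ |K| = |a - b| is integrable.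
  set K : (ℝ × ℝ) × ℝ → ℝ := fun p =>
    (if p.1.2 ≤ p.2 then 1 else 0) - (if p.1.1 ≤ p.2 then 1 else 0) with hK
  have hm2 : MeasurableSet {p : (ℝ × ℝ) × ℝ | p.1.2 ≤ p.2} :=
    measurableSet_le (by fun_prop) (by fun_prop)
  have hm1 : MeasurableSet {p : (ℝ × ℝ) × ℝ | p.1.1 ≤ p.2} :=
    measurableSet_le (by fun_prop) (by fun_prop)
  have hKm : Measurable K := (Measurable.ite hm2 measurable_const measurable_const).sub
    (Measurable.ite hm1 measurable_const measurable_const)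
  have hsub : Integrable (fun z : ℝ × ℝ => |z.1 - z.2|) (P.prod Q) :=
    ((hP.comp_fst Q).sub (hQ.comp_snd P)).abs
  have hKi : Integrable K ((P.prod Q).prod volume) := by
    refine (integrable_prod_iff hKm.aestronglyMeasurable).2
      ⟨ae_of_all _ fun z => (integrable_ite_sub_ite z.1 z.2).1, hsub.congr ?_⟩
    exact ae_of_all _ fun z => (integrable_ite_sub_ite z.1 z.2).2.symm
  have hcdf : ∀ t, ∫ z, K (z, t) ∂(P.prod Q) = cdf Q t - cdf P t := by
    intro t
    have e : ∀ (ρ : Measure ℝ) [IsProbabilityMeasure ρ],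
        Integrable (fun x : ℝ => if x ≤ t then (1 : ℝ) else 0) ρ ∧
        ∫ x, (if x ≤ t then (1 : ℝ) else 0) ∂ρ = cdf ρ t := by
      intro ρ _
      have h1 : (fun x : ℝ => if x ≤ t then (1 : ℝ) else 0) = (Set.Iic t).indicator 1 := by
        ext x; simp [Set.indicator]
      rw [h1, integral_indicator_one measurableSet_Iic, cdf_eq_real]
      exact ⟨(integrable_const (1 : ℝ)).indicator measurableSet_Iic, rfl⟩
    rw [hK]
    simp only
    rw [integral_sub ((e Q).1.comp_snd P) ((e P).1.comp_fst Q),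
      integral_fun_snd (fun x : ℝ => if x ≤ t then (1 : ℝ) else 0),
      integral_fun_fst (fun x : ℝ => if x ≤ t then (1 : ℝ) else 0), (e Q).2, (e P).2]
    simp
  refine ⟨hKi.integral_prod_right.congr (ae_of_all _ hcdf), fun h g hg hgb hh => ?_⟩
  have hhi : ∀ {R : Measure ℝ} [IsProbabilityMeasure R], Integrable id R → Integrable h R := by
    intro R _ hR
    refine (hR.abs.add (integrable_const |h 0|)).mono'
      (continuous_iff_continuousAt.2 fun x => (hh x).continuousAt).aestronglyMeasurable
      (ae_of_all _ fun x => ?_)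
    have h1 := abs_sub_le_of_hasDerivAt hh hgb x 0
    rw [sub_zero, one_mul] at h1
    have h2 := abs_sub_abs_le_abs_sub (h x) (h 0)
    simp only [Pi.add_apply, id, Real.norm_eq_abs]
    linarith
  have hgK : Integrable (fun p : (ℝ × ℝ) × ℝ => g p.2 * K p) ((P.prod Q).prod volume) :=
    hKi.bdd_mul (hg.comp continuous_snd).aestronglyMeasurable (ae_of_all _ fun p => hgb p.2)
  have e1 : ∫ z : ℝ × ℝ, (h z.1 - h z.2) ∂(P.prod Q) = ∫ x, h x ∂P - ∫ x, h x ∂Q := by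
    rw [integral_sub ((hhi hP).comp_fst Q) ((hhi hQ).comp_snd P), integral_fun_fst h,
      integral_fun_snd h]
    simp
  rw [← e1]
  calc ∫ z : ℝ × ℝ, (h z.1 - h z.2) ∂(P.prod Q)
      = ∫ z : ℝ × ℝ, (∫ t, g t * K (z, t)) ∂(P.prod Q) := by
        congr 1; ext z
        exact (integral_mul_ite_sub_ite hg hh z.1 z.2).symm
    _ = ∫ t, ∫ z : ℝ × ℝ, g t * K (z, t) ∂(P.prod Q) := integral_integral_swap hgK
    _ = ∫ t, g t * (cdf Q t - cdf P t) := by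
        congr 1; ext t
        rw [integral_const_mul, hcdf]

/-- The sign of D is replaced by G / (|G| + w), where G is continuous and `L¹`-close to D, and the
positive integrable w keeps the quotient continuous at zeros of G. -/
lemma integral_abs_le_of_forall_continuous {D : ℝ → ℝ} (hD : Integrable D) {B : ℝ}
    (hB : ∀ g : ℝ → ℝ, Continuous g → (∀ x, |g x| ≤ 1) → ∫ t, g t * D t ≤ B) :
    ∫ t, |D t| ≤ B := by
  refine le_of_forall_pos_le_add fun δ hδ => ?_
  set s := √(2 * Real.pi) with hs
  have hspos : 0 < s := Real.sqrt_pos.2 (by positivity)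
  obtain ⟨G, hG, hGi⟩ := hD.exists_boundedContinuous_integral_sub_le (ε := δ / 3) (by positivity)
  set w : ℝ → ℝ := fun t => δ / 3 / s * gaussWeight t with hw
  have hwpos : ∀ t, 0 < w t := fun t => mul_pos (by positivity) (gaussWeight_pos t)
  have hwi : Integrable w := integrable_gaussWeight.const_mul _
  have hwint : ∫ t, w t = δ / 3 := by
    rw [hw, integral_const_mul, integral_gaussWeight, ← hs]; field_simp
  have hden : ∀ t, 0 < |G t| + w t := fun t => by have := hwpos t; positivity
  set g : ℝ → ℝ := fun t => G t / (|G t| + w t) with hg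
  have hgc : Continuous g :=
    G.continuous.div (G.continuous.abs.add (continuous_const.mul continuous_gaussWeight))
      fun t => (hden t).ne'
  have hg1 : ∀ t, |g t| ≤ 1 := fun t => by
    rw [hg, abs_div, abs_of_pos (hden t), div_le_one (hden t)]
    linarith [hwpos t]
  have hgD : Integrable fun t => g t * D t :=
    hD.bdd_mul hgc.aestronglyMeasurable (ae_of_all _ hg1)
  have hsub : Integrable fun t => ‖D t - G t‖ := (hD.sub hGi).norm
  have hpt : ∀ t, |D t| ≤ g t * D t + (2 * ‖D t - G t‖ + w t) := by
    intro t
    have h1 : |G t| - w t ≤ g t * G t := by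
      have : g t * G t = |G t| ^ 2 / (|G t| + w t) := by
        rw [sq_abs, hg]; ring
      rw [this, le_div_iff₀ (hden t)]
      nlinarith [hwpos t]
    have h2 : |g t * (D t - G t)| ≤ |D t - G t| := by
      rw [abs_mul]
      exact mul_le_of_le_one_left (abs_nonneg _) (hg1 t)
    have h3 := abs_sub_abs_le_abs_sub (D t) (G t)
    have h4 := neg_abs_le (g t * (D t - G t))
    rw [Real.norm_eq_abs]
    nlinarith
  calc ∫ t, |D t| ≤ ∫ t, (g t * D t + (2 * ‖D t - G t‖ + w t)) :=
        integral_mono hD.abs (hgD.add ((hsub.const_mul 2).fun_add hwi)) hpt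
    _ = (∫ t, g t * D t) + (2 * (∫ t, ‖D t - G t‖) + δ / 3) := by
        rw [integral_add hgD ((hsub.const_mul 2).fun_add hwi), integral_add (hsub.const_mul 2) hwi,
          integral_const_mul, hwint]
    _ ≤ B + δ := by linarith [hB g hgc hg1]

/-- A bound for the Wasserstein distance by means of `C¹` test functions with Lipschitz
constant `1`. -/
theorem wassersteinDist_le_of_forall_integral_sub_le {P Q : Measure ℝ} [IsProbabilityMeasure P]
    [IsProbabilityMeasure Q] (hP : Integrable id P) (hQ : Integrable id Q) {B : ℝ}
    (hB : ∀ h g : ℝ → ℝ, Continuous g → (∀ x, |g x| ≤ 1) → (∀ x, HasDerivAt h (g x) x) →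
      ∫ x, h x ∂P - ∫ x, h x ∂Q ≤ B) :
    wassersteinDist P Q ≤ ENNReal.ofReal B := by
  obtain ⟨hi, hd⟩ := integral_cdf_sub_cdf hP hQ
  refine (wassersteinDist_le_lintegral_cdf P Q).trans ?_
  simp only [abs_sub_comm (cdf P _)]
  rw [← ofReal_integral_eq_lintegral_ofReal hi.abs (ae_of_all _ fun t => abs_nonneg _)]
  refine ENNReal.ofReal_le_ofReal (integral_abs_le_of_forall_continuous hi fun g hg hgb => ?_)
  have hder : ∀ x, HasDerivAt (fun x => ∫ t in (0 : ℝ)..x, g t) (g x) x := fun x =>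
    intervalIntegral.integral_hasDerivAt_right (hg.intervalIntegrable _ _)
      hg.aestronglyMeasurable.stronglyMeasurableAtFilter hg.continuousAt
  rw [← hd _ g hg hgb hder]
  exact hB _ g hg hgb hder

/-! ### The bound for one row and the limit -/

section RowBound

variable {Ω : Type*} [MeasurableSpace Ω] {μ : Measure Ω} [IsProbabilityMeasure μ]

lemma wassersteinDist_gaussianReal_sum_le {ι : Type*} [Fintype ι] {X : ι → Ω → ℝ}
    (hX : ∀ k, Measurable (X k)) (hX2 : ∀ k, MemLp (X k) 2 μ)
    (hind : iIndepFun X μ) (h0 : ∀ k, ∫ ω, X k ω ∂μ = 0) (hsum : ∑ k, ∫ ω, X k ω ^ 2 ∂μ = 1)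
    {ε : ℝ} (hε : 0 < ε) (hσ : ∀ k, ∫ ω, X k ω ^ 2 ∂μ ≤ ε ^ 2) :
    wassersteinDist (gaussianReal 0 1) (μ.map fun ω => ∑ k, X k ω) ≤
      ENNReal.ofReal (8 * ∑ k, (∫ ω in {ω | ε < |X k ω|}, X k ω ^ 2 ∂μ) + 12 * ε) := by
  have hSm : Measurable fun ω => ∑ k, X k ω := Finset.measurable_fun_sum _ fun k _ => hX k
  have := Measure.isProbabilityMeasure_map (μ := μ) hSm.aemeasurable
  have hSi : Integrable (fun ω => ∑ k, X k ω) μ :=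
    integrable_finsetSum _ fun k _ => (hX2 k).integrable (by norm_num)
  refine wassersteinDist_le_of_forall_integral_sub_le
    ((memLp_id_gaussianReal' 1 (by simp)).integrable le_rfl)
    ((integrable_map_measure measurable_id.aestronglyMeasurable hSm.aemeasurable).2 hSi)
    fun h g hg hgb hh => ?_
  obtain ⟨f, f', hf, hfb, hf'b, hf'l, hstein⟩ := exists_stein_solution hg hgb hh
  have hhc : Continuous h := continuous_iff_continuousAt.2 fun x => (hh x).continuousAt
  have hhi : Integrable (fun ω => h (∑ k, X k ω)) μ := by
    refine (hSi.abs.add (integrable_const |h 0|)).mono'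
      (hhc.measurable.comp hSm).aestronglyMeasurable (ae_of_all _ fun ω => ?_)
    have h1 := abs_sub_le_of_hasDerivAt hh hgb (∑ k, X k ω) 0
    rw [sub_zero, one_mul] at h1
    have h2 := abs_sub_abs_le_abs_sub (h (∑ k, X k ω)) (h 0)
    simp only [Pi.add_apply, Real.norm_eq_abs]
    linarith
  have hb := abs_integral_stein_le hf hfb hf'b hf'l hX hX2 hind h0 hsum hε hσ
  simp only [hstein] at hb
  rw [integral_sub hhi (integrable_const _), integral_const, probReal_univ, one_smul,
    abs_sub_comm] at hb
  rw [integral_map hSm.aemeasurable hhc.aestronglyMeasurable]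
  exact (le_abs_self _).trans hb

end RowBound

theorem theorem4p3 {Ω : Type*} [MeasurableSpace Ω] (μ : Measure Ω) [IsProbabilityMeasure μ]
    (ξ : Ω → ℝ) (hξ : HasLaw ξ (gaussianReal 0 1) μ)
    (X : ℕ → ℕ → Ω → ℝ) (hX : IsSTA μ X) (hF : FellerCondition μ X) :
    limsup (fun n : ℕ =>
        wassersteinDist (μ.map ξ) (μ.map fun ω => ∑ k ∈ Finset.Icc 1 n, X n k ω)) atTop
      ≤ 8 * lindebergIndex μ X := by
  rw [hξ.map_eq]
  have hrow : ∀ ε : ℝ, 0 < ε → ∀ᶠ n in atTop,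
      wassersteinDist (gaussianReal 0 1) (μ.map fun ω => ∑ k ∈ Finset.Icc 1 n, X n k ω) ≤
        8 * (∑ k ∈ Finset.Icc 1 n,
          ∫⁻ ω in {ω | ε < |X n k ω|}, ENNReal.ofReal (X n k ω ^ 2) ∂μ) +
          ENNReal.ofReal (12 * ε) := by
    intro ε hε
    -- Feller's condition makes every variance in the row smaller than ε². Row 0 is excluded since
    -- its variances have an empty sum.
    filter_upwards [hF.eventually_lt_const (ENNReal.ofReal_pos.2 (pow_pos hε 2)),
      eventually_ge_atTop 1] with n hn hn1
    have hsq : ∀ k ∈ Finset.Icc 1 n, Integrable (fun ω => X n k ω ^ 2) μ := fun k hk =>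
      (hX.memLp n k hk).integrable_sq
    have hσ : ∀ k ∈ Finset.Icc 1 n, ∫ ω, X n k ω ^ 2 ∂μ ≤ ε ^ 2 := by
      intro k hk
      have h1 := (Finset.le_sup (f := fun k => ∫⁻ ω, ENNReal.ofReal (X n k ω ^ 2) ∂μ) hk).trans
        hn.le
      rwa [← ofReal_integral_eq_lintegral_ofReal (hsq k hk) (ae_of_all _ fun ω => sq_nonneg _),
        ENNReal.ofReal_le_ofReal_iff (by positivity)] at h1
    have hsum := hX.sum_variance n hn1
    rw [← Finset.sum_coe_sort] at hsum
    have h := wassersteinDist_gaussianReal_sum_le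
      (fun k : Finset.Icc 1 n => hX.measurable n k k.2) (fun k => hX.memLp n k k.2) (hX.indep n)
      (fun k => hX.mean_zero n k k.2) hsum hε (fun k => hσ k k.2)
    have e1 : ∀ ω, ∑ k : Finset.Icc 1 n, X n k ω = ∑ k ∈ Finset.Icc 1 n, X n k ω := fun ω =>
      Finset.sum_coe_sort (Finset.Icc 1 n) fun k => X n k ω
    have hnn : ∀ k ∈ Finset.Icc 1 n, 0 ≤ ∫ ω in {ω | ε < |X n k ω|}, X n k ω ^ 2 ∂μ :=
      fun k _ => integral_nonneg fun ω => sq_nonneg _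
    simp only [e1] at h
    rw [Finset.sum_coe_sort (Finset.Icc 1 n)
        fun k => ∫ ω in {ω | ε < |X n k ω|}, X n k ω ^ 2 ∂μ,
      ENNReal.ofReal_add (mul_nonneg (by norm_num) (Finset.sum_nonneg hnn)) (by positivity),
      ENNReal.ofReal_mul (by norm_num), ENNReal.ofReal_sum_of_nonneg hnn] at h
    refine h.trans_eq ?_
    congr 2
    · norm_num
    · refine Finset.sum_congr rfl fun k hk => ?_
      exact ofReal_integral_eq_lintegral_ofReal (hsq k hk).integrableOn
        (ae_of_all _ fun ω => sq_nonneg _)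
  have hlim : ∀ ε : ℝ, 0 < ε →
      limsup (fun n : ℕ => wassersteinDist (gaussianReal 0 1)
        (μ.map fun ω => ∑ k ∈ Finset.Icc 1 n, X n k ω)) atTop ≤
      8 * lindebergIndex μ X + ENNReal.ofReal (12 * ε) := by
    intro ε hε
    refine (limsup_le_limsup (hrow ε hε)).trans ?_
    -- A monotone continuous map commutes with the limsup, which moves the affine bound outside.
    have hmono : Monotone fun x : ℝ≥0∞ => 8 * x + ENNReal.ofReal (12 * ε) := fun x y hxy => by
      dsimp only; gcongr
    have hcont : Continuous fun x : ℝ≥0∞ => 8 * x + ENNReal.ofReal (12 * ε) :=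
      (ENNReal.continuous_const_mul (by simp)).add continuous_const
    refine (hmono.map_limsup_of_continuousAt (F := atTop) (fun n : ℕ => ∑ k ∈ Finset.Icc 1 n,
      ∫⁻ ω in {ω | ε < |X n k ω|}, ENNReal.ofReal (X n k ω ^ 2) ∂μ)
      hcont.continuousAt).symm.trans_le (hmono ?_)
    exact le_iSup₂_of_le (f := fun (ε : ℝ) (_ : 0 < ε) =>
      limsup (fun n : ℕ => ∑ k ∈ Finset.Icc 1 n,
        ∫⁻ ω in {ω | ε < |X n k ω|}, ENNReal.ofReal (X n k ω ^ 2) ∂μ) atTop) ε hε le_rfl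
  refine ENNReal.le_of_forall_pos_le_add fun δ hδ _ => ?_
  have h := hlim (δ / 12) (by positivity)
  rwa [mul_div_cancel₀ _ (by norm_num), ENNReal.ofReal_coe_nnreal] at h
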